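/- **Theorem 1.3 (Boundedness and rapid growth).** Let $p=(p_0,\dots,p_m)$ be a probability vector ($p_j\ge 0$, $\sum_{j=0}^m p_j=1$) with $p_0>0$, $p_1=0$ and $\sum_{j=0}^m (1-j)p_j=0$. Let the polynomials $P_n$, $n\ge 0$, be defined by $P_k(z)=z^k$ for $0\le k\le m-1$ and $$P_{k+1}(z)=\frac{z-p_1}{p_0}P_k(z)-\sum_{j=2}^m\frac{p_j}{p_0}P_{k+1-j}(z)\qquad\text{for } k\ge m-1.$$ Let $\gamma\subset\mathbb{C}$ be the closed curve $z(t)=\sum_{j=0}^m p_j e^{i(1-j)t}$, $t\in[0,2\pi]$, and let $\Gamma$ be the closed region enclosed by $\gamma$, that is, the closure of the union of the bounded connected components of $\mathbb{C}\setminus\gamma$, together with $\gamma$ itself. Let $\sigma>0$ be given by $\sigma^2=\sum_{j=0}^m(1-j)^2p_j$, the variance of the mean-zero random variable $Y$ with $\mathbb{P}(Y=1-j)=p_j$. Then there are constants $C,c>0$, depending only on $p$, such that $$|P_n(z)|\le C\qquad\text{for all } z\in\Gamma \text{ and all } n\ge 0,$$ and $$|P_n(1+\varepsilon)|\ge c\left(1+\sigma^{-1}\sqrt{2\varepsilon}\right)^n\qquad\text{for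 all } \varepsilon>0 \text{ and all } n\ge 0.$$ -/

import Mathlib

open Polynomial

noncomputable section

/-- The polynomials `P_n` attached to a vector `p = (p_0, …, p_m)`: `P_n = z ^ n` for `n < m`, and
`P_{k+1} = ((z - p_1) / p_0) P_k - ∑_{j=2}^m (p_j / p_0) P_{k+1-j}` for `k + 1 ≥ m`.
In the sum `2 ≤ j ≤ m ≤ k + 1`, so the natural number subtraction `k + 1 - j` is exact. -/
def walkPoly (m : ℕ) (p : Fin (m + 1) → ℝ) : ℕ → ℂ[X]
  | 0 => 1
  | k + 1 =>
    if k + 1 < m then X ^ (k + 1)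
    else
      C (1 / (p 0 : ℂ)) * (X - C (p 1 : ℂ)) * walkPoly m p k -
        ∑ j : Fin (m + 1),
          if _h : 2 ≤ (j : ℕ) then
            C ((p j : ℂ) / (p 0 : ℂ)) * walkPoly m p (k + 1 - (j : ℕ))
          else 0
  termination_by n => n
  decreasing_by all_goals omega

/-- The parametrized curve `z(t) = ∑_{j=0}^m p_j e^{i (1 - j) t}`. -/
def walkCurve (m : ℕ) (p : Fin (m + 1) → ℝ) (t : ℝ) : ℂ :=
  ∑ j : Fin (m + 1), (p j : ℂ) * Complex.exp (Complex.I * (1 - ((j : ℕ) : ℂ)) * (t : ℂ))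

/-- The closed curve `γ`, as a subset of the plane: the trace of `z(t)`, `t ∈ [0, 2π]`. -/
def walkTrace (m : ℕ) (p : Fin (m + 1) → ℝ) : Set ℂ :=
  walkCurve m p '' Set.Icc 0 (2 * Real.pi)

/-- The open region enclosed by a plane set `S`: the union of the bounded connected components of
the complement of `S`. -/
def enclosedRegion (S : Set ℂ) : Set ℂ :=
  {z | z ∉ S ∧ Bornology.IsBounded (connectedComponentIn Sᶜ z)}

/-- The closed region `Γ` enclosed by `γ`: the closure of the enclosed open region, together with
`γ` itself. The curve is a part of that closure whenever it is a Jordan curve; adding it matters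
only when `γ` collapses to the segment `[-1, 1]` (`p_0 = p_2 = 1 / 2`, the Chebyshev polynomials),
which encloses no open set and is then itself the region. -/
def walkRegion (m : ℕ) (p : Fin (m + 1) → ℝ) : Set ℂ :=
  closure (enclosedRegion (walkTrace m p)) ∪ walkTrace m p

/-- The standard deviation `σ` of the step `Y` with `ℙ(Y = 1 - j) = p_j`, which has mean zero:
`σ ^ 2 = 𝔼 Y ^ 2 = ∑_{j=0}^m (1 - j) ^ 2 p_j`. -/
def stepDeviation (m : ℕ) (p : Fin (m + 1) → ℝ) : ℝ :=
  Real.sqrt (∑ j : Fin (m + 1), (1 - ((j : ℕ) : ℝ)) ^ 2 * p j)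

end

/-!
Write `z = ∑ j, p j * w ^ (1 - j)` and `u = w⁻¹`. After division by the exponential solution `w ^ n`,
the recurrence says that `q n = P_n(z) * u ^ n` satisfies
`∑ j, a j * (q (N - j) - q (N - 1)) = 0` for `N ≥ m`, with the tilted weights
`a j = p j * w ^ (1 - j)`. It has a conserved quantity `J` (`renewalSum`, `renewalSum_eq`), which
differs from `F * q (N - 1)`, where `F = ∑ j, (1 - j) * a j`, only by increments of `q`.

*Growth.* For `z = 1 + ε` there is a real `w > 1`, and comparison with the second order Taylor
polynomial at `1` gives `z ≤ 1 + σ ^ 2 * (w - 1) ^ 2 / 2`, that is, `w ≥ 1 + σ⁻¹ * √(2 * ε)`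
(`tilt_le_quadratic`). The weights are nonnegative, so `q` decreases because it does so initially,
whence `J ≤ F * q n`. Since `F ≤ σ ^ 2 * (w - 1)` and the initial values give
`J ≥ p 0 ^ m * (w - 1)`, the factors `w - 1` cancel and `q n ≥ p 0 ^ m / σ ^ 2` uniformly in `ε`
(`le_of_real_recurrence`).

*Boundedness.* On the curve `|w| = 1`. The mean zero condition makes the increments of `q` bounded
by the initial ones, that is, by `δ = |z * u - 1|`; so `|F| * |q n| ≤ |F| + O(δ)`. Both `F` and
`z * u - 1` are polynomials in `u`, up to a unimodular factor, and on the unit circle they vanish at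
the same points, where the zeros of `F` are simple; hence `δ = O(|F|)`
(`exists_norm_sum_le_mul_norm_sum`) and `q` is bounded uniformly (`norm_le_of_unimodular`). The
maximum principle carries the bound to the enclosed region.
-/

/-! ### The recurrence as a harmonicity relation -/

lemma two_le_of_mean_zero {m : ℕ} {p : Fin (m + 1) → ℝ} (hp_zero : 0 < p 0)
    (hp_mean : ∑ j : Fin (m + 1), (1 - ((j : ℕ) : ℝ)) * p j = 0) : 2 ≤ m := by
  rcases m with _ | _ | m
  · simp at hp_mean
    linarith
  · simp [Fin.sum_univ_two] at hp_mean
    linarith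
  · omega

lemma walkPoly_eval_of_lt {m : ℕ} (p : Fin (m + 1) → ℝ) (z : ℂ) {k : ℕ} (hk : k < m) :
    (walkPoly m p k).eval z = z ^ k := by
  rcases k with _ | k
  · simp [walkPoly]
  · rw [walkPoly, if_pos hk]
    simp

lemma mul_walkPoly_eval {m : ℕ} {p : Fin (m + 1) → ℝ} (hm : 2 ≤ m) (hp_zero : 0 < p 0)
    (hp_one : p 1 = 0) (z : ℂ) {N : ℕ} (hN : m ≤ N) :
    z * (walkPoly m p (N - 1)).eval z
      = ∑ j : Fin (m + 1), (p j : ℂ) * (walkPoly m p (N - j)).eval z := by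
  obtain ⟨k, rfl⟩ : ∃ k, N = k + 1 := ⟨N - 1, by omega⟩
  have h0 : (p 0 : ℂ) ≠ 0 := by exact_mod_cast hp_zero.ne'
  have hstep : (p 0 : ℂ) * (walkPoly m p (k + 1)).eval z = z * (walkPoly m p k).eval z
      - ∑ j : Fin (m + 1), if 2 ≤ (j : ℕ) then
          (p j : ℂ) * (walkPoly m p (k + 1 - j)).eval z else 0 := by
    rw [walkPoly, if_neg (by omega)]
    simp only [hp_one, eval_sub, eval_mul, eval_C, eval_X, eval_finsetSum, mul_sub,
      Finset.mul_sum]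
    congr 1
    · simp
      field_simp
    · refine Finset.sum_congr rfl fun j _ => ?_
      split_ifs
      · simp
        field_simp
      · simp
  have hsplit : ∀ j : Fin (m + 1), (p j : ℂ) * (walkPoly m p (k + 1 - j)).eval z
      = (if j = 0 then (p 0 : ℂ) * (walkPoly m p (k + 1)).eval z else 0)
        + if 2 ≤ (j : ℕ) then (p j : ℂ) * (walkPoly m p (k + 1 - j)).eval z else 0 := by
    intro j
    by_cases hj0 : j = 0
    · subst hj0
      simp
    · by_cases hj : 2 ≤ (j : ℕ)
      · simp [hj0, hj]
      · have : j = 1 := by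
          have : (j : ℕ) ≠ 0 := fun h => hj0 (Fin.ext h)
          apply Fin.ext
          rw [Fin.val_one']
          rw [Nat.mod_eq_of_lt (by omega)]
          omega
        rw [if_neg hj0, if_neg hj, this, hp_one]
        simp
  rw [Finset.sum_congr rfl fun j _ => hsplit j, Finset.sum_add_distrib,
    Finset.sum_ite_eq' Finset.univ (0 : Fin (m + 1)), if_pos (Finset.mem_univ _), hstep]
  simp

/-- The recurrence for `x n * u ^ n`, with the tilted weights `p j * w ^ (1 - j)`, written without
negative powers as `p j * (w * u ^ j)`, where `u` is the inverse of `w`. -/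
lemma recurrence_rescale {K : Type*} [CommRing K] {m : ℕ} {p : Fin (m + 1) → K} {x : ℕ → K}
    {z w u : K} (hm : 2 ≤ m) (hwu : w * u = 1)
    (hrec : ∀ N, m ≤ N → z * x (N - 1) = ∑ j : Fin (m + 1), p j * x (N - j))
    (hz : z = ∑ j : Fin (m + 1), p j * (w * u ^ (j : ℕ))) {N : ℕ} (hN : m ≤ N) :
    ∑ j : Fin (m + 1), p j * (w * u ^ (j : ℕ))
      * (x (N - j) * u ^ (N - j) - x (N - 1) * u ^ (N - 1)) = 0 := by
  have hpow : u ^ (N - 1) = w * u ^ N := by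
    obtain ⟨k, rfl⟩ : ∃ k, N = k + 1 := ⟨N - 1, by omega⟩
    rw [pow_succ, Nat.add_sub_cancel]
    linear_combination (-u ^ k) * hwu
  have h1 : ∑ j : Fin (m + 1), p j * (w * u ^ (j : ℕ)) * (x (N - j) * u ^ (N - j))
      = (w * u ^ N) * ∑ j : Fin (m + 1), p j * x (N - j) := by
    rw [Finset.mul_sum]
    refine Finset.sum_congr rfl fun j _ => ?_
    have : u ^ N = u ^ (j : ℕ) * u ^ (N - j) := by
      rw [← pow_add]
      congr 1
      omega
    rw [this]
    ring
  simp only [mul_sub, Finset.sum_sub_distrib]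
  rw [h1, ← Finset.sum_mul, ← hz, ← hrec N hN, hpow]
  ring

/-- The summed form `∑ j, a j * (R (N - j) - R (N - 1))` of the recurrence
`∑ j, a j * (q (N - j) - q (N - 1)) = 0`, where `R n = ∑ i < n, q i`. -/
def renewalSum {K : Type*} [CommRing K] {m : ℕ} (a : Fin (m + 1) → K) (q : ℕ → K) (N : ℕ) : K :=
  ∑ j : Fin (m + 1), a j * (∑ i ∈ Finset.range (N - j), q i - ∑ i ∈ Finset.range (N - 1), q i)

lemma renewalSum_eq {K : Type*} [CommRing K] {m : ℕ} {a : Fin (m + 1) → K} {q : ℕ → K}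
    (hm : 2 ≤ m)
    (hq : ∀ N, m ≤ N → ∑ j : Fin (m + 1), a j * (q (N - j) - q (N - 1)) = 0) {N : ℕ}
    (hN : m ≤ N) : renewalSum a q N = renewalSum a q m := by
  induction N, hN using Nat.le_induction with
  | base => rfl
  | succ N hN ih =>
    rw [← ih, ← sub_eq_zero, renewalSum, renewalSum, ← Finset.sum_sub_distrib, ← hq N hN]
    refine Finset.sum_congr rfl fun j _ => ?_
    have e1 : N + 1 - (j : ℕ) = (N - j) + 1 := by omega
    have e2 : N + 1 - 1 = (N - 1) + 1 := by omega
    rw [e1, e2, Finset.sum_range_succ, Finset.sum_range_succ]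
    ring

/-- Each coefficient of `renewalSum` is `(1 - j) * q (N - 1)` up to increments of `q`; for `j = 0`
there is no error, and the sum over `Finset.Ico (N - j) (N - 1)` is empty for `j ≤ 1`. -/
lemma sum_range_sub_sum_range {K : Type*} [CommRing K] (q : ℕ → K) {N j : ℕ} (hN : 1 ≤ N)
    (hj : j ≤ N) :
    ∑ i ∈ Finset.range (N - j), q i - ∑ i ∈ Finset.range (N - 1), q i
      = (1 - (j : K)) * q (N - 1) - ∑ i ∈ Finset.Ico (N - j) (N - 1), (q i - q (N - 1)) := by
  rcases j with _ | j
  · obtain ⟨k, rfl⟩ : ∃ k, N = k + 1 := ⟨N - 1, by omega⟩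
    simp [Finset.sum_range_succ]
  · have hle : N - (j + 1) ≤ N - 1 := by omega
    rw [Finset.sum_sub_distrib, Finset.sum_Ico_eq_sub _ hle, Finset.sum_const, Nat.card_Ico,
      show N - 1 - (N - (j + 1)) = j by omega, nsmul_eq_mul]
    push_cast
    ring

/-! ### Growth to the right of `1` -/

/-- `w ^ (1 - j)` is at most its second order Taylor polynomial at `1`. -/
lemma inv_pow_le_quadratic {w u : ℝ} (hw : 1 ≤ w) (hwu : w * u = 1) (j : ℕ) :
    w * u ^ j ≤ 1 + (1 - (j : ℝ)) * (w - 1)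
      + ((1 - (j : ℝ)) ^ 2 - (1 - (j : ℝ))) / 2 * (w - 1) ^ 2 := by
  rcases j with _ | k
  · simp
  · have hk : w * u ^ (k + 1) = u ^ k := by
      rw [pow_succ]
      linear_combination u ^ k * hwu
    rw [hk]
    push_cast
    have hu : 0 < u := by
      by_contra! h
      nlinarith
    induction k with
    | zero => simp
    | succ k ih =>
      have ih := ih (by rw [pow_succ]; linear_combination u ^ k * hwu)
      have key : u ^ (k + 1) * w = u ^ k := by
        rw [pow_succ]
        linear_combination u ^ k * hwu
      refine le_of_mul_le_mul_right ?_ (by linarith : 0 < w)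
      rw [key]
      refine ih.trans ?_
      have hs : 0 ≤ (w - 1) ^ 3 := pow_nonneg (by linarith) 3
      have hk0 : (0 : ℝ) ≤ k := k.cast_nonneg
      push_cast
      nlinarith [mul_nonneg (by positivity : (0 : ℝ) ≤ (k + 1) * (k + 2)) hs]

/-- The bounds `1 - j ≤ (1 - j) * w ^ (1 - j) ≤ (1 - j) + (1 - j) ^ 2 * (w - 1)`. -/
lemma tilted_weight_bounds {w u : ℝ} (hw : 1 ≤ w) (hwu : w * u = 1) (j : ℕ) :
    (1 - (j : ℝ)) ≤ w * u ^ j * (1 - (j : ℝ)) ∧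
    w * u ^ j * (1 - (j : ℝ)) ≤ (1 - (j : ℝ)) + (1 - (j : ℝ)) ^ 2 * (w - 1) := by
  rcases j with _ | k
  · simp [hw]
  · have hk : w * u ^ (k + 1) = u ^ k := by
      rw [pow_succ]
      linear_combination u ^ k * hwu
    have hu : 0 < u := by
      by_contra! h
      nlinarith
    have hu1 : u ≤ 1 := by nlinarith
    have hk0 : (0 : ℝ) ≤ k := k.cast_nonneg
    have h1 : u ^ k ≤ 1 := pow_le_one₀ hu.le hu1
    have h2 : 1 + (k : ℝ) * (u - 1) ≤ u ^ k := one_add_mul_sub_le_pow (by linarith) k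
    have h3 : -(w - 1) ≤ u - 1 := by nlinarith
    rw [hk]
    push_cast
    constructor
    · nlinarith
    · nlinarith [mul_le_mul_of_nonneg_left h3 hk0, mul_le_mul_of_nonneg_left h2 hk0,
        mul_le_mul_of_nonneg_left h3 (mul_nonneg hk0 hk0)]

section Growth

variable {m : ℕ} {p : Fin (m + 1) → ℝ}

/-- Every `z > 1` is `∑ j, p j * w ^ (1 - j)` for some `w > 1`: the sum is `1` at `w = 1`, and its
term with `j = 0` alone is `z` at `w = z / p 0`. -/
lemma exists_tilt (hp_nonneg : ∀ j, 0 ≤ p j) (hp_sum : ∑ j, p j = 1) (hp_zero : 0 < p 0)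
    {z : ℝ} (hz : 1 < z) :
    ∃ w u : ℝ, 1 < w ∧ w * u = 1 ∧ z = ∑ j : Fin (m + 1), p j * (w * u ^ (j : ℕ)) := by
  have hp01 : p 0 ≤ 1 := hp_sum ▸ Finset.single_le_sum (fun j _ => hp_nonneg j) (Finset.mem_univ 0)
  have hle : 1 ≤ z / p 0 := by
    rw [le_div_iff₀ hp_zero]
    linarith
  have hcont : ContinuousOn (fun w : ℝ => ∑ j : Fin (m + 1), p j * (w * w⁻¹ ^ (j : ℕ)))
      (Set.Icc 1 (z / p 0)) := by
    have hinv : ContinuousOn (fun w : ℝ => w⁻¹) (Set.Icc 1 (z / p 0)) :=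
      continuousOn_inv₀.mono fun w hw => (zero_lt_one.trans_le hw.1).ne'
    fun_prop
  have hmem : z ∈ Set.Icc (∑ j : Fin (m + 1), p j * (1 * (1 : ℝ)⁻¹ ^ (j : ℕ)))
      (∑ j : Fin (m + 1), p j * (z / p 0 * (z / p 0)⁻¹ ^ (j : ℕ))) := by
    constructor
    · simpa [hp_sum] using hz.le
    · have := Finset.single_le_sum (f := fun j : Fin (m + 1) =>
        p j * (z / p 0 * (z / p 0)⁻¹ ^ (j : ℕ)))
        (fun j _ => mul_nonneg (hp_nonneg j) (by positivity)) (Finset.mem_univ 0)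
      refine le_trans (le_of_eq ?_) this
      simp
      field_simp
  obtain ⟨w, hw, hwz⟩ := intermediate_value_Icc hle hcont hmem
  have hwz : ∑ j : Fin (m + 1), p j * (w * w⁻¹ ^ (j : ℕ)) = z := hwz
  refine ⟨w, w⁻¹, lt_of_le_of_ne hw.1 ?_, mul_inv_cancel₀ (by linarith [hw.1]), hwz.symm⟩
  rintro rfl
  simp [hp_sum] at hwz
  linarith

lemma tilt_le_quadratic (hp_nonneg : ∀ j, 0 ≤ p j) (hp_sum : ∑ j, p j = 1)
    (hp_mean : ∑ j : Fin (m + 1), (1 - ((j : ℕ) : ℝ)) * p j = 0)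
    {w u : ℝ} (hw : 1 ≤ w) (hwu : w * u = 1) :
    ∑ j : Fin (m + 1), p j * (w * u ^ (j : ℕ))
      ≤ 1 + (∑ j : Fin (m + 1), (1 - ((j : ℕ) : ℝ)) ^ 2 * p j) / 2 * (w - 1) ^ 2 := by
  refine (Finset.sum_le_sum fun (j : Fin (m + 1)) _ =>
    mul_le_mul_of_nonneg_left (inv_pow_le_quadratic hw hwu j) (hp_nonneg j)).trans (le_of_eq ?_)
  have h : ∀ j : Fin (m + 1), p j * (1 + (1 - ((j : ℕ) : ℝ)) * (w - 1)
      + ((1 - ((j : ℕ) : ℝ)) ^ 2 - (1 - ((j : ℕ) : ℝ))) / 2 * (w - 1) ^ 2)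
      = p j + (1 - ((j : ℕ) : ℝ)) * p j * ((w - 1) - (w - 1) ^ 2 / 2)
        + (1 - ((j : ℕ) : ℝ)) ^ 2 * p j * ((w - 1) ^ 2 / 2) := fun j => by ring
  rw [Finset.sum_congr rfl fun j _ => h j, Finset.sum_add_distrib, Finset.sum_add_distrib,
    ← Finset.sum_mul, ← Finset.sum_mul, hp_sum, hp_mean]
  ring

/-- If the first values of `q` decrease, then so do all values, as the next increment is an average
of earlier ones with nonnegative weights. -/
lemma antitone_of_recurrence {a : Fin (m + 1) → ℝ} {q : ℕ → ℝ} (ha : ∀ j, 0 ≤ a j)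
    (ha0 : 0 < a 0) (hq : ∀ N, m ≤ N → ∑ j : Fin (m + 1), a j * (q (N - j) - q (N - 1)) = 0)
    (hinit : ∀ k, k + 1 < m → q (k + 1) ≤ q k) : Antitone q := by
  refine antitone_nat_of_succ_le fun k => ?_
  induction k using Nat.strong_induction_on with
  | _ k ih =>
    rcases lt_or_ge (k + 1) m with hk | hk
    · exact hinit k hk
    · have hanti : ∀ d, d ≤ k → q k ≤ q (k - d) := by
        intro d
        induction d with
        | zero => simp
        | succ d ihd =>
          intro hd
          refine (ihd (by omega)).trans ?_
          have := ih (k - (d + 1)) (by omega)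
          rwa [show k - (d + 1) + 1 = k - d by omega] at this
      have h := hq (k + 1) hk
      rw [Fin.sum_univ_succ] at h
      have hnn : 0 ≤ ∑ i : Fin m, a i.succ * (q (k + 1 - (i.succ : Fin (m + 1))) - q (k + 1 - 1)) := by
        refine Finset.sum_nonneg fun i _ => mul_nonneg (ha _) ?_
        have := hanti i (by omega)
        simp only [Fin.val_succ, Nat.add_sub_add_right, Nat.add_sub_cancel]
        linarith
      simp only [Fin.val_zero, Nat.sub_zero, Nat.add_sub_cancel] at h hnn
      by_contra! hlt
      have := mul_pos ha0 (sub_pos.2 hlt)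
      linarith

/-- The lower bound for solutions of the recurrence at a point `z > 1`: after division by the
exponential solution `w ^ n` the sequence decreases, and the value of `renewalSum` prevents it from
going below `p 0 ^ m / σ ^ 2`. -/
lemma le_of_real_recurrence (hp_nonneg : ∀ j, 0 ≤ p j) (hp_zero : 0 < p 0)
    (hp_mean : ∑ j : Fin (m + 1), (1 - ((j : ℕ) : ℝ)) * p j = 0)
    {x : ℕ → ℝ} {z w u : ℝ} (hz1 : 1 ≤ z) (hw : 1 < w) (hwu : w * u = 1)
    (hz : z = ∑ j : Fin (m + 1), p j * (w * u ^ (j : ℕ))) (hzw : z ≤ w)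
    (hrec : ∀ N, m ≤ N → z * x (N - 1) = ∑ j : Fin (m + 1), p j * x (N - j))
    (hinit : ∀ k < m, x k = z ^ k) (n : ℕ) :
    p 0 ^ m / (∑ j : Fin (m + 1), (1 - ((j : ℕ) : ℝ)) ^ 2 * p j) * w ^ n ≤ x n := by
  have hm := two_le_of_mean_zero hp_zero hp_mean
  set V := ∑ j : Fin (m + 1), (1 - ((j : ℕ) : ℝ)) ^ 2 * p j with hV
  have hu : 0 < u := by
    by_contra! h
    nlinarith
  have hVpos : 0 < V := by
    have := Finset.single_le_sum (f := fun j : Fin (m + 1) => (1 - ((j : ℕ) : ℝ)) ^ 2 * p j)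
      (fun j _ => mul_nonneg (sq_nonneg _) (hp_nonneg j)) (Finset.mem_univ 0)
    simp at this
    linarith
  set a : Fin (m + 1) → ℝ := fun j => p j * (w * u ^ (j : ℕ)) with ha_def
  set q : ℕ → ℝ := fun k => x k * u ^ k with hq_def
  set r := z * u with hr
  have ha : ∀ j, 0 ≤ a j := fun j => mul_nonneg (hp_nonneg j) (by positivity)
  have hr1 : r ≤ 1 := by nlinarith
  have hru : u ≤ r := by nlinarith
  have hr0 : 0 < r := by linarith
  have hqinit : ∀ k < m, q k = r ^ k := fun k hk => by
    simp only [hq_def, hinit k hk, hr, mul_pow]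
  have hq : ∀ N, m ≤ N → ∑ j : Fin (m + 1), a j * (q (N - j) - q (N - 1)) = 0 :=
    fun N hN => recurrence_rescale hm hwu hrec hz hN
  have hanti : Antitone q := by
    refine antitone_of_recurrence ha ?_ hq fun k hk => ?_
    · simp only [ha_def]
      simpa using mul_pos hp_zero (by linarith : 0 < w)
    · rw [hqinit _ hk, hqinit k (by omega)]
      exact pow_le_pow_of_le_one hr0.le hr1 (Nat.le_succ k)
  -- The exponential `w ^ (1 - j)` is at most `r ^ i` for `i ≤ j - 1`, since `w⁻¹ ≤ r ≤ 1`; so the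
  -- mean zero condition bounds `renewalSum` from below.
  have hlow : p 0 * (w - 1) * r ^ (m - 1) ≤ renewalSum a q m := by
    have hterm : ∀ j : Fin (m + 1),
        ((1 - ((j : ℕ) : ℝ)) * p j + if j = 0 then p 0 * (w - 1) else 0) * r ^ (m - 1)
        ≤ a j * (∑ i ∈ Finset.range (m - j), q i - ∑ i ∈ Finset.range (m - 1), q i) := by
      intro j
      rcases Fin.eq_zero_or_eq_succ j with rfl | ⟨i, rfl⟩
      · have : Finset.range (m - ((0 : Fin (m + 1)) : ℕ)) = Finset.range (m - 1 + 1) := by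
          congr 1
          simp
          omega
        rw [this, Finset.sum_range_succ, hqinit (m - 1) (by omega)]
        simp [ha_def]
        linarith
      · have hle : m - (i + 1 : ℕ) ≤ m - 1 := by omega
        have hsum : ∑ l ∈ Finset.Ico (m - (i + 1 : ℕ)) (m - 1), q l * u ^ (i : ℕ)
            ≤ ∑ l ∈ Finset.Ico (m - (i + 1 : ℕ)) (m - 1), r ^ (m - 1) := by
          refine Finset.sum_le_sum fun l hl => ?_
          rw [Finset.mem_Ico] at hl
          rw [hqinit l (by omega)]
          calc r ^ l * u ^ (i : ℕ) ≤ r ^ l * r ^ (i : ℕ) := by gcongr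
            _ = r ^ (l + i) := (pow_add _ _ _).symm
            _ ≤ r ^ (m - 1) := pow_le_pow_of_le_one hr0.le hr1 (by omega)
        rw [Finset.sum_const, Nat.card_Ico, nsmul_eq_mul,
          show m - 1 - (m - (i + 1 : ℕ)) = i by omega, ← Finset.sum_mul,
          Finset.sum_Ico_eq_sub _ hle] at hsum
        have hai : a i.succ = p i.succ * u ^ (i : ℕ) := by
          simp only [ha_def, Fin.val_succ, pow_succ]
          linear_combination p i.succ * u ^ (i : ℕ) * hwu
        rw [hai, if_neg (Fin.succ_ne_zero i)]
        simp only [Fin.val_succ]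
        push_cast
        nlinarith [mul_le_mul_of_nonneg_left hsum (hp_nonneg i.succ)]
    have hs := Finset.sum_le_sum fun j (_ : j ∈ Finset.univ) => hterm j
    rw [← Finset.sum_mul, Finset.sum_add_distrib, hp_mean,
      Finset.sum_ite_eq' Finset.univ (0 : Fin (m + 1))] at hs
    simpa [renewalSum] using hs
  set F := ∑ j : Fin (m + 1), a j * (1 - ((j : ℕ) : ℝ)) with hF
  have hF0 : 0 ≤ F := by
    rw [← hp_mean]
    refine Finset.sum_le_sum fun j _ => ?_
    have := mul_le_mul_of_nonneg_left (tilted_weight_bounds hw.le hwu j).1 (hp_nonneg j)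
    simp only [ha_def]
    linarith
  have hFV : F ≤ V * (w - 1) := by
    have : V * (w - 1) = ∑ j : Fin (m + 1), ((1 - ((j : ℕ) : ℝ)) * p j
        + (1 - ((j : ℕ) : ℝ)) ^ 2 * p j * (w - 1)) := by
      rw [Finset.sum_add_distrib, hp_mean, ← Finset.sum_mul, zero_add]
    rw [this]
    refine Finset.sum_le_sum fun j _ => ?_
    have := mul_le_mul_of_nonneg_left (tilted_weight_bounds hw.le hwu j).2 (hp_nonneg j)
    simp only [ha_def]
    linarith
  have hup : ∀ N, m ≤ N → renewalSum a q N ≤ F * q (N - 1) := by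
    intro N hN
    rw [hF, Finset.sum_mul]
    refine Finset.sum_le_sum fun j _ => ?_
    rw [sum_range_sub_sum_range q (by omega) (by omega), mul_assoc (a j)]
    refine mul_le_mul_of_nonneg_left ?_ (ha j)
    have : 0 ≤ ∑ i ∈ Finset.Ico (N - (j : ℕ)) (N - 1), (q i - q (N - 1)) :=
      Finset.sum_nonneg fun i hi => sub_nonneg.2 (hanti (Finset.mem_Ico.1 hi).2.le)
    linarith
  have hp0r : p 0 ≤ r := by
    have := Finset.single_le_sum (f := a) (fun j _ => ha j) (Finset.mem_univ 0)
    rw [← hz] at this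
    simp [ha_def] at this
    nlinarith
  have hqn : p 0 ^ m / V ≤ q n := by
    have h1 : p 0 * (w - 1) * r ^ (m - 1) ≤ F * q (n + m - 1) := by
      refine hlow.trans ?_
      rw [← renewalSum_eq hm hq (Nat.le_add_left m n)]
      exact hup _ (Nat.le_add_left m n)
    have h2 : 0 < F * q (n + m - 1) :=
      lt_of_lt_of_le (mul_pos (mul_pos hp_zero (by linarith)) (pow_pos hr0 _)) h1
    have h3 : 0 < q (n + m - 1) := pos_of_mul_pos_right h2 hF0
    refine le_trans ?_ (hanti (show n ≤ n + m - 1 by omega))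
    rw [div_le_iff₀ hVpos]
    have h4 : p 0 ^ m ≤ p 0 * r ^ (m - 1) := by
      obtain ⟨k, rfl⟩ : ∃ k, m = k + 1 := ⟨m - 1, by omega⟩
      rw [pow_succ, Nat.add_sub_cancel, mul_comm]
      gcongr
    have h5 : p 0 * (w - 1) * r ^ (m - 1) ≤ V * (w - 1) * q (n + m - 1) :=
      h1.trans (mul_le_mul_of_nonneg_right hFV h3.le)
    have h6 : 0 < w - 1 := by linarith
    refine le_of_mul_le_mul_right ?_ h6
    nlinarith
  have hxq : x n = q n * w ^ n := by
    simp only [hq_def]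
    rw [mul_assoc, ← mul_pow, mul_comm u w, hwu, one_pow, mul_one]
  rw [hxq]
  gcongr

/-- The tilt satisfies `z ≤ w` because all exponents `1 - j` are at most `1`. -/
lemma tilt_le_self (hp_nonneg : ∀ j, 0 ≤ p j) (hp_sum : ∑ j, p j = 1) {w u : ℝ} (hw : 1 ≤ w)
    (hwu : w * u = 1) : ∑ j : Fin (m + 1), p j * (w * u ^ (j : ℕ)) ≤ w := by
  have hu : 0 < u := by
    by_contra! h
    nlinarith
  have hu1 : u ≤ 1 := by nlinarith
  calc _ ≤ ∑ j : Fin (m + 1), p j * w := by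
        refine Finset.sum_le_sum fun j _ => mul_le_mul_of_nonneg_left ?_ (hp_nonneg j)
        exact mul_le_of_le_one_right (by linarith) (pow_le_one₀ hu.le hu1)
    _ = w := by rw [← Finset.sum_mul, hp_sum, one_mul]

lemma walkPoly_growth (hp_nonneg : ∀ j, 0 ≤ p j) (hp_sum : ∑ j, p j = 1) (hp_zero : 0 < p 0)
    (hp_mean : ∑ j : Fin (m + 1), (1 - ((j : ℕ) : ℝ)) * p j = 0) (hp_one : p 1 = 0) :
    ∃ c : ℝ, 0 < c ∧ ∀ ε : ℝ, 0 < ε → ∀ n : ℕ,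
      c * (1 + (stepDeviation m p)⁻¹ * Real.sqrt (2 * ε)) ^ n
        ≤ ‖(walkPoly m p n).eval (1 + (ε : ℂ))‖ := by
  have hm := two_le_of_mean_zero hp_zero hp_mean
  set V := ∑ j : Fin (m + 1), (1 - ((j : ℕ) : ℝ)) ^ 2 * p j with hV
  have hVpos : 0 < V := by
    have := Finset.single_le_sum (f := fun j : Fin (m + 1) => (1 - ((j : ℕ) : ℝ)) ^ 2 * p j)
      (fun j _ => mul_nonneg (sq_nonneg _) (hp_nonneg j)) (Finset.mem_univ 0)
    simp at this
    linarith
  refine ⟨p 0 ^ m / V, by positivity, fun ε hε n => ?_⟩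
  obtain ⟨w, u, hw, hwu, hz⟩ := exists_tilt hp_nonneg hp_sum hp_zero (by linarith : 1 < 1 + ε)
  have hrate : 1 + (stepDeviation m p)⁻¹ * Real.sqrt (2 * ε) ≤ w := by
    have h := tilt_le_quadratic hp_nonneg hp_sum hp_mean hw.le hwu
    rw [← hz, ← hV] at h
    rw [stepDeviation, ← hV, ← Real.sqrt_inv, ← Real.sqrt_mul (by positivity)]
    have : Real.sqrt (V⁻¹ * (2 * ε)) ≤ w - 1 := by
      rw [Real.sqrt_le_left (by linarith), inv_mul_le_iff₀ hVpos]
      linarith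
    linarith
  have hcast : (1 + (ε : ℂ)) = ((1 + ε : ℝ) : ℂ) := by push_cast; rfl
  have hmain := le_of_real_recurrence (x := fun k => ((walkPoly m p k).eval (1 + (ε : ℂ))).re)
    hp_nonneg hp_zero hp_mean (by linarith : 1 ≤ 1 + ε) hw hwu hz
    (hz ▸ tilt_le_self hp_nonneg hp_sum hw.le hwu)
    (fun N hN => by
      have := congrArg Complex.re (mul_walkPoly_eval hm hp_zero hp_one (1 + (ε : ℂ)) hN)
      simp only [Complex.re_sum, Complex.re_ofReal_mul] at this
      rw [← this, hcast, Complex.re_ofReal_mul])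
    (fun k hk => by
      rw [walkPoly_eval_of_lt p _ hk, hcast, ← Complex.ofReal_pow, Complex.ofReal_re]) n
  refine le_trans ?_ (hmain.trans (Complex.re_le_norm _))
  have : 0 ≤ (stepDeviation m p)⁻¹ * Real.sqrt (2 * ε) :=
    mul_nonneg (inv_nonneg.2 (Real.sqrt_nonneg _)) (Real.sqrt_nonneg _)
  gcongr

end Growth

/-! ### Boundedness on the curve -/

section Circle

variable {m : ℕ} {p : Fin (m + 1) → ℝ}

lemma Complex.eq_one_of_norm_one_of_re {v : ℂ} (hv : ‖v‖ = 1) (hre : v.re = 1) : v = 1 := by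
  have h : v.re ^ 2 + v.im ^ 2 = 1 := by
    have := Complex.sq_norm v
    rw [hv, Complex.normSq_apply] at this
    linarith
  have him : v.im = 0 := by
    rw [hre] at h
    exact pow_eq_zero_iff two_ne_zero |>.1 (by linarith)
  exact Complex.ext (by simp [hre]) (by simp [him])

/-- On the unit circle the two sums have the same zeros, the `d`-th roots of unity with `d` the
greatest common divisor of the support of `p`, and there the sum on the right has simple zeros:
the quotient of both by `1 - u ^ d` leaves a nonvanishing function on the right. -/
lemma exists_norm_sum_le_mul_norm_sum (hp_nonneg : ∀ j, 0 ≤ p j) (hp_zero : 0 < p 0)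
    (hp_mean : ∑ j : Fin (m + 1), (1 - ((j : ℕ) : ℝ)) * p j = 0) (hp_one : p 1 = 0) :
    ∃ B : ℝ, ∀ u : ℂ, ‖u‖ = 1 → ‖∑ j : Fin (m + 1), (p j : ℂ) * (1 - u ^ (j : ℕ))‖
      ≤ B * ‖∑ j : Fin (m + 1), (((((j : ℕ) : ℝ) - 1) * p j : ℝ) : ℂ) * (1 - u ^ (j : ℕ))‖ := by
  have hm := two_le_of_mean_zero hp_zero hp_mean
  set S : Finset (Fin (m + 1)) := Finset.univ.filter fun j => p j ≠ 0 ∧ j ≠ 0 with hS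
  set d := S.gcd fun j => (j : ℕ) with hd
  have hS2 : ∀ j ∈ S, 2 ≤ (j : ℕ) := by
    intro j hj
    simp only [hS, Finset.mem_filter, Finset.mem_univ, true_and] at hj
    have h0 : (j : ℕ) ≠ 0 := fun h => hj.2 (Fin.ext h)
    have h1 : (j : ℕ) ≠ 1 := by
      intro h
      refine hj.1 ?_
      rw [← hp_one]
      congr 1
      apply Fin.ext
      rw [Fin.val_one', Nat.mod_eq_of_lt (by omega), h]
    omega
  obtain ⟨j₀, hj₀⟩ : S.Nonempty := by
    by_contra hne
    rw [Finset.not_nonempty_iff_eq_empty] at hne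
    have h : ∀ j : Fin (m + 1), j ≠ 0 → p j = 0 := fun j hj => by
      by_contra hpj
      have : j ∈ S := by simp [hS, hpj, hj]
      simp [hne] at this
    rw [Finset.sum_eq_single 0 (fun j _ hj => by rw [h j hj, mul_zero]) (by simp)] at hp_mean
    simp at hp_mean
    linarith
  have hdvd : ∀ j ∈ S, d ∣ (j : ℕ) := fun j hj => Finset.gcd_dvd hj
  have hdpos : 0 < d := Nat.pos_of_dvd_of_pos (hdvd j₀ hj₀) (by linarith [hS2 j₀ hj₀])
  -- The factorization of `1 - u ^ j` by `1 - u ^ d`.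
  have hfac : ∀ (u : ℂ) (j : Fin (m + 1)), (p j : ℂ) * (1 - u ^ (j : ℕ))
      = (1 - u ^ d) * ((p j : ℂ) * ∑ i ∈ Finset.range ((j : ℕ) / d), (u ^ d) ^ i) := by
    intro u j
    by_cases hj : j ∈ S
    · rw [mul_left_comm, mul_neg_geom_sum, ← pow_mul, Nat.mul_div_cancel' (hdvd j hj)]
    · by_cases hj0 : j = 0
      · simp [hj0]
      · have : p j = 0 := by
          by_contra hpj
          exact hj (by simp [hS, hpj, hj0])
        simp [this]
  set H : ℂ → ℂ := fun u => ∑ j : Fin (m + 1),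
    (p j : ℂ) * ∑ i ∈ Finset.range ((j : ℕ) / d), (u ^ d) ^ i with hH
  set G : ℂ → ℂ := fun u => ∑ j : Fin (m + 1),
    (((j : ℕ) : ℂ) - 1) * ((p j : ℂ) * ∑ i ∈ Finset.range ((j : ℕ) / d), (u ^ d) ^ i) with hG
  have hHfac : ∀ u : ℂ, ∑ j : Fin (m + 1), (p j : ℂ) * (1 - u ^ (j : ℕ)) = (1 - u ^ d) * H u := by
    intro u
    simp only [hH, Finset.mul_sum (s := Finset.univ), hfac]
  have hGfac : ∀ u : ℂ, ∑ j : Fin (m + 1), (((((j : ℕ) : ℝ) - 1) * p j : ℝ) : ℂ)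
      * (1 - u ^ (j : ℕ)) = (1 - u ^ d) * G u := by
    intro u
    simp only [hG, Finset.mul_sum (s := Finset.univ)]
    refine Finset.sum_congr rfl fun j _ => ?_
    have := hfac u j
    push_cast
    linear_combination (((j : ℕ) : ℂ) - 1) * this
  have hcoeff : ∀ j : Fin (m + 1), j ≠ 0 → 0 ≤ (((j : ℕ) : ℝ) - 1) * p j := by
    intro j hj
    have : 1 ≤ (j : ℕ) := Nat.pos_of_ne_zero fun h => hj (Fin.ext h)
    have : (1 : ℝ) ≤ (j : ℕ) := by exact_mod_cast this
    exact mul_nonneg (by linarith) (hp_nonneg j)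
  have hcoeff_pos : ∀ j ∈ S, 0 < (((j : ℕ) : ℝ) - 1) * p j := by
    intro j hj
    have h2 : (2 : ℝ) ≤ (j : ℕ) := by exact_mod_cast hS2 j hj
    have hpj : p j ≠ 0 := by
      simp only [hS, Finset.mem_filter] at hj
      exact hj.2.1
    exact mul_pos (by linarith) (lt_of_le_of_ne (hp_nonneg j) hpj.symm)
  have hGne : ∀ u : ℂ, ‖u‖ = 1 → G u ≠ 0 := by
    intro u hu hGu
    by_cases hud : u ^ d = 1
    · have hval : G u = ((∑ j : Fin (m + 1),
          (((j : ℕ) : ℝ) - 1) * p j * (((j : ℕ) / d : ℕ) : ℝ) : ℝ) : ℂ) := by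
        simp only [hG, hud]
        push_cast
        refine Finset.sum_congr rfl fun j _ => ?_
        simp
        ring
      have hpos : 0 < ∑ j : Fin (m + 1), (((j : ℕ) : ℝ) - 1) * p j * (((j : ℕ) / d : ℕ) : ℝ) := by
        refine Finset.sum_pos' (fun j _ => ?_) ⟨j₀, Finset.mem_univ _, ?_⟩
        · by_cases hj : j = 0
          · simp [hj]
          · exact mul_nonneg (hcoeff j hj) (Nat.cast_nonneg _)
        · refine mul_pos (hcoeff_pos j₀ hj₀) (Nat.cast_pos.2 ?_)
          exact Nat.div_pos (Nat.le_of_dvd (by linarith [hS2 j₀ hj₀]) (hdvd j₀ hj₀)) hdpos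
      rw [hval] at hGu
      exact hpos.ne' (by exact_mod_cast hGu)
    · -- The real parts of the terms are nonnegative, so a vanishing sum forces `u ^ j = 1` on the
      -- support.
      have hsum := hGfac u
      rw [hGu, mul_zero] at hsum
      have hre := congrArg Complex.re hsum
      simp only [Complex.re_sum, Complex.re_ofReal_mul, Complex.sub_re, Complex.one_re,
        Complex.zero_re] at hre
      have hnorm : ∀ j : ℕ, ‖u ^ j‖ = 1 := fun j => by rw [norm_pow, hu, one_pow]
      rw [Finset.sum_eq_zero_iff_of_nonneg] at hre
      · refine hud (orderOf_dvd_iff_pow_eq_one.1 (Finset.dvd_gcd fun j hj => ?_))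
        refine orderOf_dvd_of_pow_eq_one (Complex.eq_one_of_norm_one_of_re (hnorm j) ?_)
        have := (mul_eq_zero.1 (hre j (Finset.mem_univ j))).resolve_left (hcoeff_pos j hj).ne'
        linarith
      · intro j _
        by_cases hj : j = 0
        · simp [hj]
        · refine mul_nonneg (hcoeff j hj) (sub_nonneg.2 ?_)
          exact (Complex.re_le_norm _).trans (hnorm j).le
  obtain ⟨B, hB⟩ := (isCompact_sphere (0 : ℂ) 1).exists_bound_of_continuousOn
    (f := fun u => H u / G u) (ContinuousOn.div (by fun_prop) (by fun_prop)
      fun u hu => hGne u (mem_sphere_zero_iff_norm.1 hu))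
  refine ⟨B, fun u hu => ?_⟩
  rw [hHfac, hGfac, norm_mul, norm_mul, mul_left_comm]
  refine mul_le_mul_of_nonneg_left ?_ (norm_nonneg _)
  have := hB u (mem_sphere_zero_iff_norm.2 hu)
  rwa [norm_div, div_le_iff₀ (norm_pos_iff.2 (hGne u hu))] at this

lemma norm_sub_le_of_norm_step_le {q : ℕ → ℂ} {δ : ℝ} {k : ℕ}
    (hstep : ∀ i < k, ‖q (i + 1) - q i‖ ≤ δ) {i : ℕ} (hi : i ≤ k) :
    ‖q i - q k‖ ≤ ((k - i : ℕ) : ℝ) * δ := by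
  induction k, hi using Nat.le_induction with
  | base => simp
  | succ k hk ih =>
    have h1 := ih fun l hl => hstep l (by omega)
    have h2 := hstep k (by omega)
    calc ‖q i - q (k + 1)‖ ≤ ‖q i - q k‖ + ‖q k - q (k + 1)‖ := norm_sub_le_norm_sub_add_norm_sub _ _ _
      _ ≤ ((k - i : ℕ) : ℝ) * δ + δ := add_le_add h1 (by rwa [norm_sub_rev])
      _ = ((k + 1 - i : ℕ) : ℝ) * δ := by
        rw [show k + 1 - i = k - i + 1 by omega]
        push_cast
        ring

/-- Increments of `q` never exceed the bound of the initial ones: the next increment is a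
combination of earlier ones whose weights have absolute values summing to at most `1`, by the mean
zero condition. -/
lemma norm_step_le_of_recurrence (hp_nonneg : ∀ j, 0 ≤ p j) (hp_zero : 0 < p 0)
    (hp_mean : ∑ j : Fin (m + 1), (1 - ((j : ℕ) : ℝ)) * p j = 0)
    {a : Fin (m + 1) → ℂ} {q : ℕ → ℂ} {δ : ℝ} (ha : ∀ j, ‖a j‖ = p j)
    (hq : ∀ N, m ≤ N → ∑ j : Fin (m + 1), a j * (q (N - j) - q (N - 1)) = 0)
    (hinit : ∀ k, k + 1 < m → ‖q (k + 1) - q k‖ ≤ δ) (k : ℕ) : ‖q (k + 1) - q k‖ ≤ δ := by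
  induction k using Nat.strong_induction_on with
  | _ k ih =>
    rcases lt_or_ge (k + 1) m with hk | hk
    · exact hinit k hk
    · have h := hq (k + 1) hk
      rw [Fin.sum_univ_succ] at h
      simp only [Fin.val_zero, Nat.sub_zero, Nat.add_sub_cancel, Fin.val_succ,
        Nat.add_sub_add_right] at h
      have hbound : ‖∑ i : Fin m, a i.succ * (q (k - i) - q k)‖ ≤ p 0 * δ := by
        have hmean : ∑ i : Fin m, p i.succ * (((i : ℕ) : ℝ) * δ) = p 0 * δ := by
          rw [Fin.sum_univ_succ] at hp_mean
          have : ∑ i : Fin m, p i.succ * (((i : ℕ) : ℝ) * δ)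
              = -δ * ∑ i : Fin m, (1 - (((i.succ : Fin (m + 1)) : ℕ) : ℝ)) * p i.succ := by
            rw [Finset.mul_sum]
            refine Finset.sum_congr rfl fun i _ => ?_
            rw [Fin.val_succ]
            push_cast
            ring
          rw [this]
          simp only [Fin.val_zero, Nat.cast_zero, sub_zero, one_mul] at hp_mean
          linear_combination (-δ) * hp_mean
        rw [← hmean]
        refine (norm_sum_le _ _).trans (Finset.sum_le_sum fun i _ => ?_)
        rw [norm_mul, ha]
        refine mul_le_mul_of_nonneg_left ?_ (hp_nonneg _)
        have := norm_sub_le_of_norm_step_le ih (Nat.sub_le k i)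
        rwa [show k - (k - (i : ℕ)) = i by omega] at this
      rw [add_eq_zero_iff_eq_neg] at h
      have h' := congrArg norm h
      rw [norm_mul, norm_neg, ha] at h'
      refine le_of_mul_le_mul_left ?_ hp_zero
      rw [h']
      exact hbound

/-- The bound on the solutions at the point `z = ∑ j, p j * w ^ (1 - j)` of the curve, with `|w| = 1`
and `u = w⁻¹`. With `F = ∑ j, (1 - j) * a j`, the constancy of `renewalSum` gives
`‖F‖ * ‖q n‖ ≤ ‖F‖ + 2 * m ^ 2 * δ` for the increments' bound `δ = ‖z * u - 1‖`, and `δ ≤ B * ‖F‖`. -/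
lemma norm_le_of_unimodular (hp_nonneg : ∀ j, 0 ≤ p j) (hp_sum : ∑ j, p j = 1)
    (hp_zero : 0 < p 0) (hp_mean : ∑ j : Fin (m + 1), (1 - ((j : ℕ) : ℝ)) * p j = 0)
    {B : ℝ} {x : ℕ → ℂ} {z w u : ℂ} (hu : ‖u‖ = 1) (hwu : w * u = 1)
    (hB : ‖∑ j : Fin (m + 1), (p j : ℂ) * (1 - u ^ (j : ℕ))‖
      ≤ B * ‖∑ j : Fin (m + 1), (((((j : ℕ) : ℝ) - 1) * p j : ℝ) : ℂ) * (1 - u ^ (j : ℕ))‖)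
    (hz : z = ∑ j : Fin (m + 1), (p j : ℂ) * (w * u ^ (j : ℕ)))
    (hrec : ∀ N, m ≤ N → z * x (N - 1) = ∑ j : Fin (m + 1), (p j : ℂ) * x (N - j))
    (hinit : ∀ k < m, x k = z ^ k) (n : ℕ) : ‖x n‖ ≤ 1 + 2 * m ^ 2 * |B| := by
  have hm := two_le_of_mean_zero hp_zero hp_mean
  have hw : ‖w‖ = 1 := by
    have := congrArg norm hwu
    rwa [norm_mul, hu, mul_one, norm_one] at this
  set a : Fin (m + 1) → ℂ := fun j => (p j : ℂ) * (w * u ^ (j : ℕ)) with ha_def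
  set q : ℕ → ℂ := fun k => x k * u ^ k with hq_def
  set r := z * u with hr
  set δ := ‖r - 1‖ with hδ
  have hδ0 : 0 ≤ δ := norm_nonneg _
  have ha : ∀ j, ‖a j‖ = p j := fun j => by
    simp [ha_def, hu, hw, abs_of_nonneg (hp_nonneg j)]
  have hqx : ∀ k, ‖q k‖ = ‖x k‖ := fun k => by simp [hq_def, hu]
  have hqinit : ∀ k < m, q k = r ^ k := fun k hk => by
    simp only [hq_def, hinit k hk, hr, mul_pow]
  have hr1 : ‖r‖ ≤ 1 := by
    rw [hr, norm_mul, hu, mul_one, hz, ← hp_sum]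
    exact (norm_sum_le _ _).trans (Finset.sum_le_sum fun j _ => (ha j).le)
  have hq : ∀ N, m ≤ N → ∑ j : Fin (m + 1), a j * (q (N - j) - q (N - 1)) = 0 :=
    fun N hN => recurrence_rescale hm hwu hrec hz hN
  have hstep : ∀ k, ‖q (k + 1) - q k‖ ≤ δ := by
    refine norm_step_le_of_recurrence hp_nonneg hp_zero hp_mean ha hq fun k hk => ?_
    rw [hqinit _ hk, hqinit k (by omega), pow_succ, ← mul_sub_one, norm_mul, norm_pow]
    exact mul_le_of_le_one_left hδ0 (pow_le_one₀ (norm_nonneg _) hr1)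
  set F := ∑ j : Fin (m + 1), a j * (1 - ((j : ℕ) : ℂ)) with hF
  have hδF : δ ≤ |B| * ‖F‖ := by
    have hp_sum' : ∑ j : Fin (m + 1), (p j : ℂ) = 1 := by exact_mod_cast hp_sum
    have hp_mean' : ∑ j : Fin (m + 1), (((((j : ℕ) : ℝ) - 1) * p j : ℝ) : ℂ) = 0 := by
      have : ∑ j : Fin (m + 1), (((j : ℕ) : ℝ) - 1) * p j = 0 := by
        rw [← neg_eq_zero, ← Finset.sum_neg_distrib, ← hp_mean]
        exact Finset.sum_congr rfl fun j _ => by ring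
      exact_mod_cast this
    have e1 : r - 1 = -∑ j : Fin (m + 1), (p j : ℂ) * (1 - u ^ (j : ℕ)) := by
      simp only [mul_sub, Finset.sum_sub_distrib, mul_one, hp_sum', hr, hz, Finset.sum_mul]
      rw [neg_sub]
      congr 1
      exact Finset.sum_congr rfl fun j _ => by linear_combination (p j : ℂ) * u ^ (j : ℕ) * hwu
    have e2 : F = w * ∑ j : Fin (m + 1), (((((j : ℕ) : ℝ) - 1) * p j : ℝ) : ℂ)
        * (1 - u ^ (j : ℕ)) := by
      simp only [mul_sub, Finset.sum_sub_distrib, mul_one, hp_mean']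
      rw [← mul_sub, zero_sub, mul_neg, Finset.mul_sum, ← Finset.sum_neg_distrib, hF]
      refine Finset.sum_congr rfl fun j _ => ?_
      push_cast
      ring
    rw [hδ, e1, norm_neg, e2, norm_mul, hw, one_mul]
    exact hB.trans (mul_le_mul_of_nonneg_right (le_abs_self B) (norm_nonneg _))
  have hJ : ∀ N, m ≤ N → ‖renewalSum a q N - F * q (N - 1)‖ ≤ m ^ 2 * δ := by
    intro N hN
    rw [renewalSum, hF, Finset.sum_mul, ← Finset.sum_sub_distrib]
    calc _ ≤ ∑ j : Fin (m + 1), p j * (m ^ 2 * δ) := by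
          refine (norm_sum_le _ _).trans (Finset.sum_le_sum fun j _ => ?_)
          have hjm : (j : ℕ) ≤ m := Nat.le_of_lt_succ j.2
          rw [sum_range_sub_sum_range q (by omega) (by omega), mul_assoc (a j), ← mul_sub,
            sub_sub_cancel_left, norm_mul, norm_neg, ha]
          refine mul_le_mul_of_nonneg_left ?_ (hp_nonneg j)
          have hterm : ∀ i ∈ Finset.Ico (N - (j : ℕ)) (N - 1), ‖q i - q (N - 1)‖ ≤ m * δ := by
            intro i hi
            rw [Finset.mem_Ico] at hi
            refine (norm_sub_le_of_norm_step_le (fun l _ => hstep l) hi.2.le).trans ?_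
            gcongr
            omega
          refine (norm_sum_le_of_le _ hterm).trans ?_
          rw [Finset.sum_const, Nat.card_Ico, nsmul_eq_mul, sq, mul_assoc]
          gcongr
          omega
      _ = m ^ 2 * δ := by rw [← Finset.sum_mul, hp_sum, one_mul]
  rw [← hqx]
  by_cases hF0 : F = 0
  · -- At a zero of `F` the increments vanish, and `q` is constant.
    have hδ' : δ = 0 := le_antisymm (by simpa [hF0] using hδF) hδ0
    have h := norm_sub_le_of_norm_step_le (fun l _ => hstep l) (Nat.zero_le n)
    rw [hδ', mul_zero, norm_le_zero_iff, sub_eq_zero, hqinit 0 (by omega), pow_zero] at h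
    rw [← h, norm_one]
    have : 0 ≤ 2 * (m : ℝ) ^ 2 * |B| := by positivity
    linarith
  · rcases lt_or_ge n m with hn | hn
    · rw [hqinit n hn, norm_pow]
      have : 0 ≤ 2 * (m : ℝ) ^ 2 * |B| := by positivity
      linarith [pow_le_one₀ (n := n) (norm_nonneg r) hr1]
    · have h1 := hJ (n + 1) (by omega)
      have h2 := hJ m le_rfl
      rw [renewalSum_eq hm hq (by omega), Nat.add_sub_cancel] at h1
      have h3 : ‖F * q (m - 1)‖ ≤ ‖F‖ := by
        rw [hqinit (m - 1) (by omega), norm_mul, norm_pow]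
        exact mul_le_of_le_one_right (norm_nonneg _) (pow_le_one₀ (norm_nonneg _) hr1)
      have h4 : ‖F * q n‖ ≤ ‖F‖ + 2 * m ^ 2 * δ := by
        have e : F * q n = F * q (m - 1) + (renewalSum a q m - F * q (m - 1))
            - (renewalSum a q m - F * q n) := by ring
        rw [e]
        refine (norm_sub_le _ _).trans ?_
        have := norm_add_le (F * q (m - 1)) (renewalSum a q m - F * q (m - 1))
        linarith
      have h5 : 2 * (m : ℝ) ^ 2 * δ ≤ 2 * m ^ 2 * (|B| * ‖F‖) := by gcongr
      rw [norm_mul] at h4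
      refine le_of_mul_le_mul_left ?_ (norm_pos_iff.2 hF0)
      linarith

lemma exists_norm_walkPoly_le_on_trace (hp_nonneg : ∀ j, 0 ≤ p j) (hp_sum : ∑ j, p j = 1)
    (hp_zero : 0 < p 0) (hp_mean : ∑ j : Fin (m + 1), (1 - ((j : ℕ) : ℝ)) * p j = 0)
    (hp_one : p 1 = 0) :
    ∃ M : ℝ, 0 < M ∧ ∀ n : ℕ, ∀ z ∈ walkTrace m p, ‖(walkPoly m p n).eval z‖ ≤ M := by
  have hm := two_le_of_mean_zero hp_zero hp_mean
  obtain ⟨B, hB⟩ := exists_norm_sum_le_mul_norm_sum hp_nonneg hp_zero hp_mean hp_one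
  refine ⟨1 + 2 * m ^ 2 * |B|, by positivity, ?_⟩
  rintro n _ ⟨t, -, rfl⟩
  have hu : ‖Complex.exp (-(Complex.I * t))‖ = 1 := by
    rw [← Complex.norm_exp_ofReal_mul_I (-t)]
    congr 2
    push_cast
    ring
  refine norm_le_of_unimodular hp_nonneg hp_sum hp_zero hp_mean
    (w := Complex.exp (Complex.I * t)) hu (by rw [← Complex.exp_add]; simp) (hB _ hu) ?_
    (fun N hN => mul_walkPoly_eval hm hp_zero hp_one _ hN)
    (fun k hk => walkPoly_eval_of_lt p _ hk) n
  rw [walkCurve]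
  refine Finset.sum_congr rfl fun j _ => ?_
  rw [← Complex.exp_nat_mul, ← Complex.exp_add]
  congr 2
  ring

end Circle

/-! ### The enclosed region -/

lemma frontier_connectedComponentIn_subset {S : Set ℂ} (hS : IsClosed S) {z : ℂ} :
    frontier (connectedComponentIn Sᶜ z) ⊆ S := by
  intro y hy
  by_contra hyS
  have hopen : ∀ x, IsOpen (connectedComponentIn Sᶜ x) := fun x =>
    hS.isOpen_compl.connectedComponentIn
  rw [(hopen z).frontier_eq] at hy
  obtain ⟨x, hxy, hxz⟩ := mem_closure_iff.1 hy.1 _ (hopen y) (mem_connectedComponentIn hyS)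
  apply hy.2
  rw [connectedComponentIn_eq hxz, ← connectedComponentIn_eq hxy]
  exact mem_connectedComponentIn hyS

lemma Polynomial.norm_eval_le_on_enclosedRegion {S : Set ℂ} (hS : IsClosed S) (P : ℂ[X]) {M : ℝ}
    (hM : ∀ z ∈ S, ‖P.eval z‖ ≤ M) {z : ℂ} (hz : z ∈ closure (enclosedRegion S) ∪ S) :
    ‖P.eval z‖ ≤ M := by
  rcases hz with hz | hz
  · refine closure_minimal (t := {z | ‖P.eval z‖ ≤ M}) ?_
      (isClosed_le P.continuous.norm continuous_const) hz
    rintro y ⟨hyS, hy⟩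
    exact Complex.norm_le_of_forall_mem_frontier_norm_le hy P.differentiable.diffContOnCl
      (fun x hx => hM x (frontier_connectedComponentIn_subset hS hx))
      (subset_closure (mem_connectedComponentIn hyS))
  · exact hM z hz

lemma isClosed_walkTrace (m : ℕ) (p : Fin (m + 1) → ℝ) : IsClosed (walkTrace m p) := by
  refine (isCompact_Icc.image ?_).isClosed
  unfold walkCurve
  fun_prop

theorem theorem1p3 (m : ℕ) (p : Fin (m + 1) → ℝ)
    (hp_nonneg : ∀ j, 0 ≤ p j)
    (hp_sum : ∑ j, p j = 1)
    (hp_zero : 0 < p 0)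
    (hp_mean : ∑ j : Fin (m + 1), (1 - ((j : ℕ) : ℝ)) * p j = 0)
    (hp_one : p 1 = 0) :
    (∃ C : ℝ, 0 < C ∧ ∀ n : ℕ, ∀ z ∈ walkRegion m p, ‖(walkPoly m p n).eval z‖ ≤ C) ∧
    (∃ c : ℝ, 0 < c ∧ ∀ ε : ℝ, 0 < ε → ∀ n : ℕ,
      c * (1 + (stepDeviation m p)⁻¹ * Real.sqrt (2 * ε)) ^ n
        ≤ ‖(walkPoly m p n).eval (1 + (ε : ℂ))‖) := by
  refine ⟨?_, walkPoly_growth hp_nonneg hp_sum hp_zero hp_mean hp_one⟩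
  obtain ⟨M, hM0, hM⟩ :=
    exists_norm_walkPoly_le_on_trace hp_nonneg hp_sum hp_zero hp_mean hp_one
  exact ⟨M, hM0, fun n z hz => Polynomial.norm_eval_le_on_enclosedRegion
    (isClosed_walkTrace m p) (walkPoly m p n) (hM n) hz⟩
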